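/- Let $d\ge 0$. Let $\mathbb{Z}^d$ be the vertex set of the infinite grid graph (two vertices are adjacent if they agree in all coordinates but one, in which they differ by $1$), and let $(\mathbb{Z}/n\mathbb{Z})^d$ be the vertex set of the toroidal grid graph $T^d_n$. A $d$-dimensional figure is a finite set of vertices of $\mathbb{Z}^d$, up to translation by integer vectors; it is connected if it induces a (nonempty) connected subgraph of the grid. A copy of a figure $f$ on $T^d_n$ is the image, under reduction modulo $n$, of a representative of $f$ on which this reduction is injective. Let $S$ be a (possibly infinite) set of connected $d$-dimensional figures, and let $w:S\to\mathbb{Z}^+$ be a function such that for every $x$ there are only finitely many $f\in S$ with $w(f)=x$. For integers $k\ge 0$ and $n\ge 1$, let $P_k(n)$ be the number of ways to place on $T^d_n$ an unordered finite collection of figures from $S$ (possibly using the same figure repeatedly) of total weight $k$ so that no two overlap; that is, the number of finite sets of pairs $(f,A)$, with $f\in S$ and $A$ a copy of $f$ on $T^d_n$, in which the sets $A$ of different pairs are disjoint and the sum of the weights $w(f)$ is $k$. Then there are polynomials $p_0,p_1,p_2,\dots\in\mathbb{Q}[x]$ such that: 1. for every $k$ there is $n_0$ such that for all $n\ge n_0$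 the number $P_k(n)$ is finite and $P_k(n)=p_k(n^d)$; 2. the sequence $(p_k)_{k\ge0}$ is of binomial type, that is, $p_0=1$, $p_k(0)=0$ for all $k>0$, and $$\left(\sum_{i=0}^{\infty}p_i(1)x^i\right)^m=\sum_{i=0}^{\infty}p_i(m)x^i\qquad\text{for all integers } m\ge 0.$$ -/

import Mathlib

namespace TorusPlacement

/-- The doubly infinite path graph: vertices are the integers, consecutive integers
are adjacent. -/
def infinitePath : SimpleGraph ℤ where
  Adj a b := b = a + 1 ∨ a = b + 1
  symm := ⟨fun _ _ h => h.symm⟩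
  loopless := ⟨fun _ h => by rcases h with h | h <;> omega⟩

/-- The product of `d` copies of a graph: two tuples are adjacent if they are adjacent in
one coordinate and agree in all the others. -/
def graphPower {V : Type} (G : SimpleGraph V) (d : ℕ) : SimpleGraph (Fin d → V) where
  Adj x y := ∃ i, G.Adj (x i) (y i) ∧ ∀ j, j ≠ i → x j = y j
  symm := ⟨fun _ _ h => h.elim fun i hi => ⟨i, hi.1.symm, fun j hj => (hi.2 j hj).symm⟩⟩
  loopless := ⟨fun _ h => h.elim fun _ hi => G.irrefl hi.1⟩

/-- The infinite `d`-dimensional grid graph, with vertex set `ℤ ^ d`. -/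
def infiniteGrid (d : ℕ) : SimpleGraph (Fin d → ℤ) := graphPower infinitePath d

/-- The translate of a finite set of grid vertices by the integer vector `v`. -/
def translateBy {d : ℕ} (v : Fin d → ℤ) (B : Finset (Fin d → ℤ)) : Finset (Fin d → ℤ) :=
  B.image fun x => x + v

/-- Two finite sets of grid vertices are equivalent if one is a translate of the other. -/
def translationSetoid (d : ℕ) : Setoid (Finset (Fin d → ℤ)) where
  r A B := ∃ v, B = translateBy v A
  iseqv :=
    { refl := fun A => ⟨0, by simp [translateBy]⟩
      symm := by
        rintro A B ⟨v, rfl⟩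
        refine ⟨-v, ?_⟩
        simp only [translateBy, Finset.image_image, Function.comp_def, add_neg_cancel_right,
          Finset.image_id']
      trans := by
        rintro A B C ⟨v, rfl⟩ ⟨u, rfl⟩
        refine ⟨v + u, ?_⟩
        simp only [translateBy, Finset.image_image, Function.comp_def, add_assoc] }

/-- A `d`-dimensional figure: a finite set of vertices of the infinite grid, up to
translation. -/
def Figure (d : ℕ) : Type := Quotient (translationSetoid d)

/-- The figure represented by a finite set of grid vertices. -/
def Figure.mk {d : ℕ} (B : Finset (Fin d → ℤ)) : Figure d := Quotient.mk (translationSetoid d) B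

/-- A figure is connected if the subgraph of the grid induced by a representative is connected
(so it is nonempty); the choice of the representative does not matter. -/
def Figure.IsConnected {d : ℕ} (f : Figure d) : Prop :=
  ∃ B : Finset (Fin d → ℤ), Figure.mk B = f ∧
    ((infiniteGrid d).induce (B : Set (Fin d → ℤ))).Connected

/-- The vertices of the toroidal grid graph of size `n`. -/
abbrev TorusVertex (d n : ℕ) : Type := Fin d → ZMod n

/-- Reduction of the grid vertices modulo `n`. -/
def wrap (d n : ℕ) (x : Fin d → ℤ) : TorusVertex d n := fun i => (x i : ZMod n)

/-- `A` is a copy of the figure `f` on the torus of size `n`: the reduction modulo `n` of a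
representative of `f` no two vertices of which are identified by the reduction. All
translates on the torus are obtained, as the representative is arbitrary. -/
def IsCopy {d : ℕ} (n : ℕ) (f : Figure d) (A : Finset (TorusVertex d n)) : Prop :=
  ∃ B : Finset (Fin d → ℤ), Figure.mk B = f ∧
    Set.InjOn (wrap d n) (B : Set (Fin d → ℤ)) ∧ A = B.image (wrap d n)

/-- The non-overlapping placements of total weight `k`, on the torus of size `n`, of collections
of figures from `S`. A placement is an unordered collection of pairs (figure, copy of it on the
torus), the copies being pairwise disjoint; a figure may occur with several copies. -/
def placements {d : ℕ} (S : Set (Figure d)) (w : S → ℕ+) (k n : ℕ) :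
    Set (Finset (S × Finset (TorusVertex d n))) :=
  {P | (∀ q ∈ P, IsCopy n (q.1 : Figure d) q.2) ∧
    (∀ q ∈ P, ∀ r ∈ P, q ≠ r → Disjoint q.2 r.2) ∧
    ∑ q ∈ P, (w q.1 : ℕ) = k}

/-- Polynomial sequences of binomial type (normalised without binomial coefficients). -/
structure IsBinomialType (p : ℕ → Polynomial ℚ) : Prop where
  zero_eq : p 0 = 1
  eval_zero : ∀ i, 0 < i → (p i).eval 0 = 0
  pow_eq : ∀ n : ℕ, (PowerSeries.mk fun i => (p i).eval 1) ^ n =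
    PowerSeries.mk fun i => (p i).eval (n : ℚ)

end TorusPlacement

/-! The proof is a cluster (Mayer) expansion. Copies of figures on the torus are polymers. Let `H`
be the power series, with one variable per polymer, that sums the monomials of pairwise disjoint
collections. For the Euler derivation `D` given by the weight, write `D H = C * H`; the coefficients
of `C`, the logarithmic derivative of `H`, are the numbers `cluster`. Comparing total weights gives
`k P_k = ∑ c_i P_j` over `i + j = k`, where `c_i` is the sum of all cluster coefficients of weight
`i` (`weight_mul_sum_hardCore`).

It remains to see that `c_i = n ^ d * h_i` with `h_i` independent of large `n`. Each coefficient is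
shared among the points that its multiset covers, and by translation invariance all `n ^ d` points
receive the same total (`sum_cluster_eq_mul`). Cluster coefficients vanish on multisets that split
into disjoint parts (`cluster_add_eq_zero`), so only multisets near the origin contribute to its
share; these live in a box that embeds in every large torus (`exists_sum_pointedCluster_eq`).

The recursion then identifies `P_k` with the coefficient of `t ^ k` in `exp (y * ∑ h_j t ^ j / j)`
at `y = n ^ d`, and the coefficients of such an exponential are of binomial type
(`isBinomialType_expSeq`). -/

namespace TorusPlacement

/-! ### Cluster coefficients of an abstract hard-core polymer system. -/

section Cluster

open scoped Classical
open Finset.HasAntidiagonal (antidiagonal mem_antidiagonal)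

variable {V V' X X' : Type*}

/-- The multiset of points covered by a multiset of polymers. -/
noncomputable def covering (cover : V → Finset X) : (V →₀ ℕ) →+ Multiset X :=
  Finsupp.liftAddHom fun v => multiplesHom (Multiset X) (cover v).val

/-- The indicator of the multisets of pairwise disjoint polymers. -/
noncomputable def hardCore (cover : V → Finset X) (a : V →₀ ℕ) : ℚ :=
  if (covering cover a).Nodup then 1 else 0

/-- The hard-core indicator as a power series. -/
noncomputable def hardCoreSeries (cover : V → Finset X) : MvPowerSeries V ℚ :=
  hardCore cover

/-- The image of the hard-core series under the Euler derivation given by the weight. -/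
noncomputable def weightedHardCoreSeries (cover : V → Finset X) (w : V → ℕ) :
    MvPowerSeries V ℚ :=
  fun a => (Finsupp.weight w a : ℚ) * hardCore cover a

/-- The coefficients of the logarithmic derivative of the hard-core series. -/
noncomputable def cluster (cover : V → Finset X) (w : V → ℕ) (a : V →₀ ℕ) : ℚ :=
  MvPowerSeries.coeff a (weightedHardCoreSeries cover w * (hardCoreSeries cover)⁻¹)

variable (cover : V → Finset X) (w : V → ℕ) (cover' : V' → Finset X') (w' : V' → ℕ)

@[simp]
lemma covering_single (v : V) (m : ℕ) :
    covering cover (Finsupp.single v m) = m • (cover v).val := by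
  simp [covering]

lemma mem_covering {a : V →₀ ℕ} {x : X} :
    x ∈ covering cover a ↔ ∃ v ∈ a.support, x ∈ cover v := by
  rw [covering, Finsupp.liftAddHom_apply, Finsupp.sum, Multiset.mem_sum]
  refine exists_congr fun v => and_congr_right fun hv => ?_
  simp only [multiplesHom_apply]
  rw [Multiset.mem_nsmul_of_ne_zero (Finsupp.mem_support_iff.1 hv), Finset.mem_val]

lemma hardCore_apply (a : V →₀ ℕ) :
    hardCore cover a = if (covering cover a).Nodup then 1 else 0 := rfl

@[simp]
lemma hardCore_zero : hardCore cover 0 = 1 := by simp [hardCore_apply]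

lemma hardCore_add_of_disjoint {a b : V →₀ ℕ}
    (h : Disjoint (covering cover a) (covering cover b)) :
    hardCore cover (a + b) = hardCore cover a * hardCore cover b := by
  simp only [hardCore_apply, map_add, Multiset.nodup_add, h, and_true]
  split_ifs <;> simp_all

lemma constantCoeff_hardCoreSeries :
    MvPowerSeries.constantCoeff (hardCoreSeries cover) = 1 := by
  rw [← MvPowerSeries.coeff_zero_eq_constantCoeff_apply]
  exact hardCore_zero cover

/-- This is `D H = C * H` read coefficientwise; `H` is invertible because its constant coefficient
is `1`. Later arguments use only this identity, not the inverse. -/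
lemma sum_cluster_mul_hardCore (a : V →₀ ℕ) :
    ∑ x ∈ antidiagonal a, cluster cover w x.1 * hardCore cover x.2 =
      (Finsupp.weight w a : ℚ) * hardCore cover a := by
  have h1 : weightedHardCoreSeries cover w * (hardCoreSeries cover)⁻¹ * hardCoreSeries cover =
      weightedHardCoreSeries cover w := by
    rw [mul_assoc, MvPowerSeries.inv_mul_cancel, mul_one]
    rw [constantCoeff_hardCoreSeries]
    exact one_ne_zero
  have h := congrArg (MvPowerSeries.coeff a) h1
  rw [MvPowerSeries.coeff_mul] at h
  exact h

/-- Power series over `ℚ` form a domain, so `H` can be cancelled: the convolution identity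
determines the cluster coefficients. -/
lemma eq_of_sum_mul_hardCore_eq {c c' : (V →₀ ℕ) → ℚ}
    (h : ∀ a, ∑ x ∈ antidiagonal a, c x.1 * hardCore cover x.2 =
      ∑ x ∈ antidiagonal a, c' x.1 * hardCore cover x.2) : c = c' := by
  have h0 : hardCoreSeries cover ≠ 0 := fun h0 => by
    have := constantCoeff_hardCoreSeries cover
    rw [h0, map_zero] at this
    exact zero_ne_one this
  refine mul_right_cancel₀ (M₀ := MvPowerSeries V ℚ) h0 ?_
  refine MvPowerSeries.ext fun a => ?_
  erw [MvPowerSeries.coeff_mul, MvPowerSeries.coeff_mul]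
  exact h a

@[simp]
lemma cluster_zero : cluster cover w 0 = 0 := by
  simpa using sum_cluster_mul_hardCore cover w 0

lemma sum_antidiagonal_ite_le {a b : V →₀ ℕ} (F : (V →₀ ℕ) × (V →₀ ℕ) → ℚ) :
    ∑ x ∈ antidiagonal (a + b), (if x.1 ≤ a then F x else 0) =
      ∑ x ∈ antidiagonal a, F (x.1, x.2 + b) := by
  rw [← Finset.sum_filter]
  symm
  refine Finset.sum_bij (fun x _ => (x.1, x.2 + b)) ?_ ?_ ?_ ?_
  · rintro ⟨p, q⟩ h
    rw [mem_antidiagonal] at h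
    simp only [Finset.mem_filter, mem_antidiagonal]
    refine ⟨by rw [← h, add_assoc], ?_⟩
    rw [← h]
    exact le_self_add
  · rintro ⟨p, q⟩ _ ⟨p', q'⟩ _ h
    simpa using h
  · rintro ⟨p, q⟩ h
    simp only [Finset.mem_filter, mem_antidiagonal] at h
    obtain ⟨h, hle⟩ := h
    obtain ⟨r, rfl⟩ := exists_add_of_le hle
    refine ⟨(p, r), by simp, ?_⟩
    rw [add_assoc] at h
    rw [add_left_cancel h]
  · intros
    rfl

lemma covering_mono {a b : V →₀ ℕ} (h : a ≤ b) : covering cover a ≤ covering cover b := by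
  obtain ⟨c, rfl⟩ := exists_add_of_le h
  rw [map_add]
  exact Multiset.le_add_right _ _

/-- If the first part lies below `a`, all of `b` stays in the second part and factors out of the
indicator, leaving the convolution identity at `a`. -/
lemma sum_ite_le_cluster_mul_hardCore {a b : V →₀ ℕ}
    (h : Disjoint (covering cover a) (covering cover b)) :
    ∑ x ∈ antidiagonal (a + b),
        (if x.1 ≤ a then cluster cover w x.1 * hardCore cover x.2 else 0) =
      (Finsupp.weight w a : ℚ) * hardCore cover (a + b) := by
  rw [sum_antidiagonal_ite_le (fun x => cluster cover w x.1 * hardCore cover x.2),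
    hardCore_add_of_disjoint cover h, ← mul_assoc, ← sum_cluster_mul_hardCore, Finset.sum_mul]
  refine Finset.sum_congr rfl ?_
  rintro ⟨p, q⟩ hx
  rw [mem_antidiagonal] at hx
  have hq : q ≤ a := hx ▸ le_add_self
  rw [hardCore_add_of_disjoint cover (h.mono_left (covering_mono cover hq)), mul_assoc]

/-- Every part of a sum splits along the sum. -/
lemma exists_add_of_le_add {p a b : V →₀ ℕ} (h : p ≤ a + b) :
    ∃ r ≤ a, ∃ s ≤ b, p = r + s := by
  refine ⟨p ⊓ a, inf_le_right, p - p ⊓ a, ?_, ?_⟩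
  · intro v
    have := h v
    simp only [Finsupp.coe_tsub, Pi.sub_apply, Finsupp.inf_apply, Finsupp.add_apply] at this ⊢
    omega
  · ext v
    simp only [Finsupp.coe_tsub, Pi.sub_apply, Finsupp.inf_apply, Finsupp.add_apply]
    omega

variable {cover}

lemma inf_eq_zero_of_disjoint_covering (hne : ∀ v, (cover v).Nonempty) {a b p : V →₀ ℕ}
    (h : Disjoint (covering cover a) (covering cover b)) (ha : p ≤ a) (hb : p ≤ b) : p = 0 := by
  by_contra hp
  obtain ⟨v, hv⟩ := Finsupp.support_nonempty_iff.2 hp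
  obtain ⟨x, hx⟩ := hne v
  have hx := (mem_covering cover).2 ⟨v, hv, hx⟩
  exact Multiset.disjoint_left.1 h (Multiset.mem_of_le (covering_mono cover ha) hx)
    (Multiset.mem_of_le (covering_mono cover hb) hx)

/-- The cluster coefficients vanish on disconnected multisets of polymers. -/
theorem cluster_add_eq_zero (hne : ∀ v, (cover v).Nonempty) {a b : V →₀ ℕ}
    (h : Disjoint (covering cover a) (covering cover b)) (ha : a ≠ 0) (hb : b ≠ 0) :
    cluster cover w (a + b) = 0 := by
  induction hn : (a + b).degree using Nat.strong_induction_on generalizing a b with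
  | _ n ih =>
  subst hn
  have key := sum_cluster_mul_hardCore cover w (a + b)
  -- A proper part `p` of `a + b` meeting both `a` and `b` contributes nothing, by induction on the
  -- degree. The parts below `a` and those below `b` overlap only in `0`, where the coefficient is
  -- `0`. Their sums already give the full weight of `a + b` times its indicator, so the remaining
  -- term `p = a + b` vanishes.
  have hsplit : ∀ x ∈ antidiagonal (a + b), cluster cover w x.1 * hardCore cover x.2 =
      ((if x.1 ≤ a then cluster cover w x.1 * hardCore cover x.2 else 0) +
       (if x.1 ≤ b then cluster cover w x.1 * hardCore cover x.2 else 0)) +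
       (if x = (a + b, 0) then cluster cover w x.1 * hardCore cover x.2 else 0) := by
    rintro ⟨p, q⟩ hx
    rw [mem_antidiagonal] at hx
    have hp : p ≤ a + b := hx ▸ le_self_add
    by_cases hpab : p = a + b
    · have hq : q = 0 := by
        subst hpab
        simpa using hx
      simp [hpab, hq, ha, hb]
    · have h3 : (p, q) ≠ (a + b, 0) := fun h' => hpab (Prod.ext_iff.1 h').1
      simp only [h3, if_false, add_zero]
      obtain ⟨r, hr, s, hs, rfl⟩ := exists_add_of_le_add hp
      by_cases hr0 : r = 0
      · subst hr0
        simp only [zero_add] at *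
        by_cases hsa : s ≤ a
        · simp [inf_eq_zero_of_disjoint_covering hne h hsa hs]
        · simp [hsa, hs]
      by_cases hs0 : s = 0
      · subst hs0
        simp only [add_zero] at *
        by_cases hrb : r ≤ b
        · simp [inf_eq_zero_of_disjoint_covering hne h hr hrb]
        · simp [hr, hrb]
      have hlt : (r + s).degree < (a + b).degree := by
        have hq : q ≠ 0 := by
          rintro rfl
          exact hpab (by simpa using hx)
        rw [← hx, map_add _ _ q]
        have : q.degree ≠ 0 := by rwa [Ne, Finsupp.degree_eq_zero_iff]
        dsimp only
        omega
      have h0 := ih _ hlt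
        (h.mono (covering_mono cover hr) (covering_mono cover hs)) hr0 hs0 rfl
      simp [h0]
  have hb' := sum_ite_le_cluster_mul_hardCore cover w h.symm
  rw [add_comm b a] at hb'
  rw [Finset.sum_congr rfl hsplit, Finset.sum_add_distrib, Finset.sum_add_distrib,
    sum_ite_le_cluster_mul_hardCore cover w h, hb', Finset.sum_ite_eq',
    if_pos (by simp), map_add] at key
  push_cast at key
  simp only [hardCore_zero, mul_one] at key
  linarith

variable {w cover' w'}

/-! ### Transport of cluster coefficients along embeddings. -/

section Map

variable {e : V → V'} {φ : X → X'}

lemma covering_mapDomain (hcov : ∀ v, (cover' (e v)).val = (cover v).val.map φ) (a : V →₀ ℕ) :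
    covering cover' (a.mapDomain e) = (covering cover a).map φ := by
  induction a using Finsupp.induction_linear with
  | zero => simp
  | add a b ha hb => simp [Finsupp.mapDomain_add, ha, hb]
  | single v m => simp [hcov, Multiset.map_nsmul]

lemma weight_mapDomain (hw : ∀ v, w' (e v) = w v) (a : V →₀ ℕ) :
    Finsupp.weight w' (a.mapDomain e) = Finsupp.weight w a := by
  induction a using Finsupp.induction_linear with
  | zero => simp
  | add a b ha hb => simp [Finsupp.mapDomain_add, ha, hb]
  | single v m => simp [hw, Finsupp.weight_single]

lemma injOn_covering (hφ : Set.InjOn φ {x | ∃ v, x ∈ cover v}) (a : V →₀ ℕ) :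
    Set.InjOn φ {x | x ∈ covering cover a} := by
  refine hφ.mono fun x hx => ?_
  obtain ⟨v, -, hv⟩ := (mem_covering cover).1 hx
  exact ⟨v, hv⟩

lemma hardCore_mapDomain (hcov : ∀ v, (cover' (e v)).val = (cover v).val.map φ)
    (hφ : Set.InjOn φ {x | ∃ v, x ∈ cover v}) (a : V →₀ ℕ) :
    hardCore cover' (a.mapDomain e) = hardCore cover a := by
  rw [hardCore_apply, hardCore_apply, covering_mapDomain hcov]
  congr 1
  refine propext ⟨Multiset.Nodup.of_map _, fun h => ?_⟩
  exact (Multiset.nodup_map_iff_inj_on h).2 fun x hx y hy => injOn_covering hφ a hx hy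

lemma exists_mapDomain_eq (he : Function.Injective e) {b : V' →₀ ℕ}
    (h : ∀ v ∈ b.support, ∃ u, e u = v) : ∃ a : V →₀ ℕ, a.mapDomain e = b :=
  ⟨_, Finsupp.mapDomain_comapDomain e he b h⟩

/-- Every part of an image multiset is supported in the range of `e`, hence is itself an image. -/
lemma sum_antidiagonal_mapDomain (he : Function.Injective e) (a : V →₀ ℕ)
    (F : (V' →₀ ℕ) × (V' →₀ ℕ) → ℚ) :
    ∑ x ∈ antidiagonal (a.mapDomain e), F x =
      ∑ x ∈ antidiagonal a, F (x.1.mapDomain e, x.2.mapDomain e) := by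
  have hinj := Finsupp.mapDomain_injective (M := ℕ) he
  symm
  refine Finset.sum_bij (fun x _ => (x.1.mapDomain e, x.2.mapDomain e)) ?_ ?_ ?_ ?_
  · rintro ⟨p, q⟩ h
    rw [mem_antidiagonal] at h ⊢
    rw [← h, Finsupp.mapDomain_add]
  · rintro ⟨p, q⟩ _ ⟨p', q'⟩ _ h
    rw [Prod.ext_iff] at h
    exact Prod.ext (hinj h.1) (hinj h.2)
  · rintro ⟨p, q⟩ h
    rw [mem_antidiagonal] at h
    have hmem : ∀ r ≤ a.mapDomain e, ∀ v ∈ r.support, ∃ u, e u = v := by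
      intro r hr v hv
      have := Finsupp.mapDomain_support (Finsupp.support_mono hr hv)
      obtain ⟨u, -, hu⟩ := Finset.mem_image.1 this
      exact ⟨u, hu⟩
    obtain ⟨p, rfl⟩ := exists_mapDomain_eq he (hmem p (h ▸ le_self_add))
    obtain ⟨q, rfl⟩ := exists_mapDomain_eq he (hmem q (h ▸ le_add_self))
    refine ⟨(p, q), ?_, rfl⟩
    rw [mem_antidiagonal]
    dsimp only at h
    rw [← Finsupp.mapDomain_add] at h
    exact hinj h
  · intros
    rfl

/-- The cluster coefficients are preserved by embeddings of polymer systems. -/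
theorem cluster_mapDomain (he : Function.Injective e)
    (hcov : ∀ v, (cover' (e v)).val = (cover v).val.map φ)
    (hφ : Set.InjOn φ {x | ∃ v, x ∈ cover v}) (hw : ∀ v, w' (e v) = w v) (a : V →₀ ℕ) :
    cluster cover' w' (a.mapDomain e) = cluster cover w a := by
  have h : (fun a => cluster cover' w' (a.mapDomain e)) = cluster cover w := by
    refine eq_of_sum_mul_hardCore_eq cover fun a => ?_
    have h := sum_cluster_mul_hardCore cover' w' (a.mapDomain e)
    rw [sum_antidiagonal_mapDomain he, weight_mapDomain hw, hardCore_mapDomain hcov hφ] at h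
    rw [sum_cluster_mul_hardCore, ← h]
    exact Finset.sum_congr rfl fun x _ => by rw [hardCore_mapDomain hcov hφ]
  exact congrFun h a

end Map

/-! ### Sharing among points, summation by weight, and connectivity of clusters. -/

variable (cover w)

/-- The share of the point `x` in a cluster coefficient. -/
noncomputable def pointedCluster (x : X) (a : V →₀ ℕ) : ℚ :=
  (covering cover a).count x * (cluster cover w a / (covering cover a).card)

variable {cover w}

/-- The point `o` need not be covered, so injectivity is required on `insert o _`: no other covered
point may land on `φ o`. -/
lemma pointedCluster_mapDomain {e : V → V'} {φ : X → X'} (he : Function.Injective e)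
    (hcov : ∀ v, (cover' (e v)).val = (cover v).val.map φ) {o : X}
    (hφ : Set.InjOn φ (insert o {x | ∃ v, x ∈ cover v})) (hw : ∀ v, w' (e v) = w v)
    (a : V →₀ ℕ) :
    pointedCluster cover' w' (φ o) (a.mapDomain e) = pointedCluster cover w o a := by
  have hφ' := hφ.mono (Set.subset_insert _ _)
  rw [pointedCluster, pointedCluster, cluster_mapDomain he hcov hφ' hw, covering_mapDomain hcov,
    Multiset.card_map]
  congr 2
  by_cases ho : o ∈ covering cover a
  · exact Multiset.count_map_eq_count φ _ (injOn_covering hφ' a) o ho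
  · rw [Multiset.count_eq_zero_of_notMem ho, Multiset.count_eq_zero_of_notMem]
    rintro h
    obtain ⟨y, hy, hyo⟩ := Multiset.mem_map.1 h
    obtain ⟨v, -, hv⟩ := (mem_covering cover).1 hy
    have := hφ (Set.mem_insert_of_mem _ ⟨v, hv⟩) (Set.mem_insert _ _) hyo
    exact ho (this ▸ hy)

/-- The multiplicities of the points add up to the cardinality in the denominator. It is nonzero
unless `a = 0`, where the cluster coefficient vanishes too. -/
lemma sum_pointedCluster [Fintype X] (hne : ∀ v, (cover v).Nonempty) (a : V →₀ ℕ) :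
    ∑ x, pointedCluster cover w x a = cluster cover w a := by
  simp only [pointedCluster]
  rw [← Finset.sum_mul, ← Nat.cast_sum, Multiset.sum_count_eq_card fun a _ => Finset.mem_univ a]
  by_cases ha : a = 0
  · simp [ha]
  · refine mul_div_cancel₀ _ ?_
    obtain ⟨v, hv⟩ := Finsupp.support_nonempty_iff.2 ha
    obtain ⟨x, hx⟩ := hne v
    have := Multiset.card_pos_iff_exists_mem.2 ⟨x, (mem_covering cover).2 ⟨v, hv, hx⟩⟩
    exact_mod_cast this.ne'

/-- The multisets of polymers of given total weight are finite in number if the polymers of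
bounded weight are. -/
lemma finite_weight_eq (hpos : ∀ v, 0 < w v) (hfin : ∀ k, {v | w v ≤ k}.Finite) (k : ℕ) :
    {a : V →₀ ℕ | Finsupp.weight w a = k}.Finite := by
  refine ((hfin k).toFinset.finsupp fun _ => Finset.range (k + 1)).finite_toSet.subset ?_
  intro a ha
  have ha : Finsupp.weight w a = k := ha
  rw [Finset.mem_coe, Finset.mem_finsupp_iff]
  constructor
  · intro v hv
    rw [Set.Finite.mem_toFinset]
    exact ha ▸ Finsupp.le_weight_of_ne_zero' w (Finsupp.mem_support_iff.1 hv)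
  · intro v _
    rw [Finset.mem_range, Nat.lt_succ_iff, ← ha]
    exact Finsupp.le_weight w (hpos v).ne' a

/-- Summing the convolution identity over one weight level works because the weight is additive: a
multiset with a splitting is the same as a pair of multisets with weights adding to `k`. -/
lemma weight_mul_sum_hardCore {L : ℕ → Finset (V →₀ ℕ)}
    (hL : ∀ k a, a ∈ L k ↔ Finsupp.weight w a = k) (k : ℕ) :
    (k : ℚ) * ∑ a ∈ L k, hardCore cover a =
      ∑ x ∈ antidiagonal k, (∑ a ∈ L x.1, cluster cover w a) * ∑ a ∈ L x.2, hardCore cover a := by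
  have h : ∀ a ∈ L k, (k : ℚ) * hardCore cover a =
      ∑ x ∈ antidiagonal a, cluster cover w x.1 * hardCore cover x.2 := by
    intro a ha
    rw [sum_cluster_mul_hardCore, (hL k a).1 ha]
  rw [Finset.mul_sum, Finset.sum_congr rfl h]
  simp only [Finset.sum_mul_sum, ← Finset.sum_product']
  rw [Finset.sum_sigma', Finset.sum_sigma']
  refine Finset.sum_bij'
    (fun x _ => ⟨(Finsupp.weight w x.2.1, Finsupp.weight w x.2.2), x.2⟩)
    (fun y _ => ⟨y.2.1 + y.2.2, y.2⟩) ?_ ?_ ?_ ?_ ?_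
  · rintro ⟨a, p, q⟩ h
    simp only [Finset.mem_sigma, hL, mem_antidiagonal, Finset.mem_product] at h ⊢
    rw [← h.1, ← h.2, map_add]
    simp
  · rintro ⟨⟨i, j⟩, p, q⟩ h
    simp only [Finset.mem_sigma, hL, mem_antidiagonal, Finset.mem_product] at h ⊢
    rw [map_add, h.2.1, h.2.2]
    exact ⟨h.1, trivial⟩
  · rintro ⟨a, p, q⟩ h
    simp only [Finset.mem_sigma, mem_antidiagonal] at h
    simp [h.2]
  · rintro ⟨⟨i, j⟩, p, q⟩ h
    simp only [Finset.mem_sigma, hL, mem_antidiagonal, Finset.mem_product] at h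
    obtain ⟨-, rfl, rfl⟩ := h
    rfl
  · intros
    rfl

lemma nodup_covering_iff (hne : ∀ v, (cover v).Nonempty) (a : V →₀ ℕ) :
    (covering cover a).Nodup ↔ (∀ v, a v ≤ 1) ∧
      ∀ v ∈ a.support, ∀ u ∈ a.support, v ≠ u → Disjoint (cover v) (cover u) := by
  constructor
  · intro h
    constructor
    · intro v
      by_contra hv
      have hle : Finsupp.single v 2 ≤ a := Finsupp.single_le_iff.2 (by omega)
      have h2 := Multiset.nodup_of_le (covering_mono cover hle) h
      rw [covering_single, two_nsmul, Multiset.nodup_add, disjoint_self,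
        Multiset.bot_eq_zero, Finset.val_eq_zero] at h2
      exact (hne v).ne_empty h2.2.2
    · intro v hv u hu hvu
      have hle : Finsupp.single v 1 + Finsupp.single u 1 ≤ a := by
        intro y
        rw [Finsupp.mem_support_iff] at hv hu
        rw [Finsupp.add_apply, Finsupp.single_apply, Finsupp.single_apply]
        split_ifs with h1 h2 h2
        · exact absurd (h1.trans h2.symm) hvu
        · subst h1
          omega
        · subst h2
          omega
        · omega
      have h2 := Multiset.nodup_of_le (covering_mono cover hle) h
      rw [map_add, covering_single, covering_single, one_nsmul, one_nsmul,
        Multiset.nodup_add] at h2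
      exact Finset.disjoint_val.1 h2.2.2
  · rintro ⟨h1, h2⟩
    rw [Multiset.nodup_iff_count_le_one]
    intro x
    rw [covering, Finsupp.liftAddHom_apply, Finsupp.sum, Multiset.count_sum']
    simp only [multiplesHom_apply, Multiset.count_nsmul]
    by_cases hx : ∃ v ∈ a.support, x ∈ cover v
    · obtain ⟨v, hv, hxv⟩ := hx
      rw [Finset.sum_eq_single_of_mem v hv]
      · exact Nat.mul_le_mul (h1 v) (Multiset.nodup_iff_count_le_one.1 (cover v).nodup x)
      · intro u hu huv
        rw [Multiset.count_eq_zero_of_notMem, mul_zero]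
        exact fun hxu => Finset.disjoint_left.1 (h2 u hu v hv huv) hxu hxv
    · rw [Finset.sum_eq_zero]
      · exact zero_le_one
      · intro v hv
        rw [Multiset.count_eq_zero_of_notMem, mul_zero]
        exact fun hxv => hx ⟨v, hv, hxv⟩

/-- A property spreading along overlaps reaches, in as many steps as there are polymers, all the
polymers of a multiset with nonzero cluster coefficient. -/
lemma forall_of_cluster_ne_zero (hne : ∀ v, (cover v).Nonempty) {b : V →₀ ℕ}
    (hb : cluster cover w b ≠ 0) {Q : ℕ → V → Prop} (hmono : ∀ r v, Q r v → Q (r + 1) v)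
    (hbase : ∃ v ∈ b.support, Q 1 v)
    (hstep : ∀ r, ∀ v ∈ b.support, ∀ u x, Q r u → x ∈ cover u → x ∈ cover v → Q (r + 1) v) :
    ∀ v ∈ b.support, Q b.support.card v := by
  -- Until everything is reached, each step reaches at least one new polymer.
  have key : ∀ r, (∀ v ∈ b.support, Q (r + 1) v) ∨
      r + 1 ≤ (b.support.filter (Q (r + 1))).card := by
    intro r
    induction r with
    | zero =>
      obtain ⟨v, hv, hQ⟩ := hbase
      exact Or.inr (Finset.card_pos.2 ⟨v, Finset.mem_filter.2 ⟨hv, hQ⟩⟩)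
    | succ r ih =>
      rcases ih with ih | ih
      · exact Or.inl fun v hv => hmono _ _ (ih v hv)
      by_cases hall : ∀ v ∈ b.support, Q (r + 1) v
      · exact Or.inl fun v hv => hmono _ _ (hall v hv)
      right
      push Not at hall
      obtain ⟨y, hy, hyQ⟩ := hall
      obtain ⟨z, hz⟩ := Finset.card_pos.1 (lt_of_lt_of_le (Nat.succ_pos r) ih)
      rw [Finset.mem_filter] at hz
      -- Otherwise the reached and unreached polymers would split `b` into disjoint nonzero parts.
      have hnd : ¬ Disjoint (covering cover (b.filter (Q (r + 1))))
          (covering cover (b.filter fun v => ¬ Q (r + 1) v)) := by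
        intro hd
        refine hb ?_
        rw [← Finsupp.filter_add_filter_not b (Q (r + 1))]
        refine cluster_add_eq_zero w hne hd ?_ ?_
        · refine Finsupp.support_nonempty_iff.1 ⟨z, ?_⟩
          rw [Finsupp.support_filter, Finset.mem_filter]
          exact hz
        · refine Finsupp.support_nonempty_iff.1 ⟨y, ?_⟩
          rw [Finsupp.support_filter, Finset.mem_filter]
          exact ⟨hy, hyQ⟩
      rw [Multiset.disjoint_left] at hnd
      push Not at hnd
      obtain ⟨x, hx1, hx2⟩ := hnd
      obtain ⟨u, hu, hxu⟩ := (mem_covering cover).1 hx1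
      obtain ⟨v, hv, hxv⟩ := (mem_covering cover).1 hx2
      rw [Finsupp.support_filter, Finset.mem_filter] at hu hv
      refine lt_of_le_of_lt ih (Finset.card_lt_card ⟨?_, fun hsub => hv.2 ?_⟩)
      · exact Finset.monotone_filter_right _ fun v _ => hmono _ v
      · refine (Finset.mem_filter.1 (hsub (Finset.mem_filter.2 ⟨hv.1, ?_⟩))).2
        exact hstep _ v hv.1 u x hu.2 hxu hxv
  obtain ⟨v₀, hv₀, -⟩ := hbase
  obtain ⟨m, hm⟩ := Nat.exists_eq_succ_of_ne_zero (Finset.card_pos.2 ⟨v₀, hv₀⟩).ne'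
  rw [hm]
  rcases key m with h | h
  · exact h
  · rw [← Nat.succ_eq_add_one, ← hm] at h
    have := Finset.eq_of_subset_of_card_le (Finset.filter_subset _ _) h
    intro v hv
    rw [← this] at hv
    exact hm ▸ (Finset.mem_filter.1 hv).2

lemma card_support_le_weight (hpos : ∀ v, 0 < w v) (a : V →₀ ℕ) :
    a.support.card ≤ Finsupp.weight w a := by
  rw [Finsupp.weight_apply, Finsupp.sum, Finset.card_eq_sum_ones]
  refine Finset.sum_le_sum fun v hv => ?_
  rw [smul_eq_mul]
  exact Nat.mul_pos (Nat.pos_of_ne_zero (Finsupp.mem_support_iff.1 hv)) (hpos v)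

end Cluster

/-! ### Exponential sequences are of binomial type. -/

section Binomial

open Polynomial

/-- The coefficients of `exp (X * ∑ hⱼ tʲ / j)`, by recursion. -/
noncomputable def expSeq (h : ℕ → ℚ) : ℕ → ℚ[X]
  | 0 => 1
  | k + 1 => C (1 / (k + 1 : ℚ)) * X * ∑ i : Fin (k + 1), C (h (i + 1)) * expSeq h (k - i)

lemma expSeq_zero (h : ℕ → ℚ) : expSeq h 0 = 1 := by
  rw [expSeq]

lemma eval_expSeq_succ (h : ℕ → ℚ) (k : ℕ) (y : ℚ) :
    ((k : ℚ) + 1) * (expSeq h (k + 1)).eval y =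
      y * ∑ x ∈ Finset.HasAntidiagonal.antidiagonal k, h (x.1 + 1) * (expSeq h x.2).eval y := by
  rw [expSeq, Finset.Nat.sum_antidiagonal_eq_sum_range_succ_mk, ← Fin.sum_univ_eq_sum_range
    (fun i => h (i + 1) * (expSeq h (k - i)).eval y)]
  simp only [eval_mul, eval_C, eval_X, eval_finsetSum]
  have : (k : ℚ) + 1 ≠ 0 := by positivity
  field_simp

lemma mul_eval_expSeq {h : ℕ → ℚ} (h0 : h 0 = 0) (k : ℕ) (y : ℚ) :
    (k : ℚ) * (expSeq h k).eval y =
      ∑ x ∈ Finset.HasAntidiagonal.antidiagonal k, y * h x.1 * (expSeq h x.2).eval y := by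
  cases k with
  | zero => simp [h0]
  | succ k =>
    rw [Finset.Nat.sum_antidiagonal_succ, h0, Nat.cast_add, Nat.cast_one, eval_expSeq_succ,
      Finset.mul_sum]
    simp [mul_assoc]

/-- A sequence satisfying the recursion of `expSeq` at `y` is `expSeq` at `y`. -/
lemma eq_eval_expSeq {h : ℕ → ℚ} (h0 : h 0 = 0) {y : ℚ} {P : ℕ → ℚ} (K : ℕ) (hP0 : P 0 = 1)
    (hP : ∀ k ≤ K, (k : ℚ) * P k = ∑ x ∈ Finset.HasAntidiagonal.antidiagonal k, y * h x.1 * P x.2) :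
    ∀ k ≤ K, P k = (expSeq h k).eval y := by
  intro k
  induction k using Nat.strong_induction_on with
  | _ k ih =>
  intro hk
  rcases Nat.eq_zero_or_pos k with rfl | hpos
  · simp [hP0, expSeq_zero]
  · have hk0 : (k : ℚ) ≠ 0 := by positivity
    refine mul_left_cancel₀ hk0 ?_
    rw [hP k hk, mul_eval_expSeq h0]
    refine Finset.sum_congr rfl ?_
    rintro ⟨i, j⟩ hx
    rw [Finset.HasAntidiagonal.mem_antidiagonal] at hx
    dsimp only at hx ⊢
    -- The term `i = 0` would involve `P k` itself; `h 0 = 0` removes it.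
    rcases Nat.eq_zero_or_pos i with rfl | hi
    · simp [h0]
    · rw [ih j (by omega) (by omega)]

/-- The exponential is handled through its differential equation `F' = y G' F`, with `G' = ∑ h (i +
1) t ^ i`. -/
lemma derivative_mk_expSeq (h : ℕ → ℚ) (y : ℚ) :
    PowerSeries.derivative ℚ (PowerSeries.mk fun i => (expSeq h i).eval y) =
      PowerSeries.C y * PowerSeries.mk (fun i => h (i + 1)) *
        PowerSeries.mk fun i => (expSeq h i).eval y := by
  ext k
  rw [PowerSeries.coeff_derivative, PowerSeries.coeff_mk, mul_comm, eval_expSeq_succ, mul_assoc,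
    PowerSeries.coeff_C_mul, PowerSeries.coeff_mul]
  simp

/-- In characteristic zero the equation fixes each coefficient from the earlier ones. Both the power
and the series at `m` will be seen to solve it. -/
lemma eq_of_derivative_eq_mul {A B g : PowerSeries ℚ}
    (hA : PowerSeries.derivative ℚ A = g * A) (hB : PowerSeries.derivative ℚ B = g * B)
    (h0 : PowerSeries.coeff 0 A = PowerSeries.coeff 0 B) : A = B := by
  ext k
  induction k using Nat.strong_induction_on with
  | _ k ih =>
  cases k with
  | zero => exact h0
  | succ k =>
    have h1 := congrArg (PowerSeries.coeff k) hA
    have h2 := congrArg (PowerSeries.coeff k) hB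
    rw [PowerSeries.coeff_derivative, PowerSeries.coeff_mul] at h1 h2
    have hk : (k : ℚ) + 1 ≠ 0 := by positivity
    refine mul_right_cancel₀ hk ?_
    rw [h1, h2]
    refine Finset.sum_congr rfl fun x hx => ?_
    rw [Finset.HasAntidiagonal.mem_antidiagonal] at hx
    rw [ih x.2 (by omega)]

theorem isBinomialType_expSeq (h : ℕ → ℚ) : IsBinomialType (expSeq h) where
  zero_eq := expSeq_zero h
  eval_zero i hi := by
    obtain ⟨k, rfl⟩ := Nat.exists_eq_succ_of_ne_zero hi.ne'
    rw [Nat.succ_eq_add_one, expSeq]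
    simp
  pow_eq m := by
    refine eq_of_derivative_eq_mul
      (g := PowerSeries.C (m : ℚ) * PowerSeries.mk fun i => h (i + 1)) ?_
      (derivative_mk_expSeq h m) ?_
    · cases m with
      | zero => simp
      | succ m =>
        rw [Derivation.leibniz_pow, derivative_mk_expSeq, Nat.add_sub_cancel, map_one, one_mul,
          map_natCast, smul_eq_mul, nsmul_eq_mul]
        ring
    · simp [expSeq_zero, PowerSeries.coeff_zero_eq_constantCoeff]

end Binomial

/-! ### Polymers on the torus: counting and translation invariance. -/

section Torus

open scoped Classical

variable {d : ℕ} {S : Set (Figure d)}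

lemma mk_translateBy (u : Fin d → ℤ) (B : Finset (Fin d → ℤ)) :
    Figure.mk (translateBy u B) = Figure.mk B :=
  Quotient.sound ((translationSetoid d).symm ⟨u, rfl⟩)

lemma wrap_add (n : ℕ) (x y : Fin d → ℤ) : wrap d n (x + y) = wrap d n x + wrap d n y := by
  ext i
  simp [wrap]

lemma wrap_zero (n : ℕ) : wrap d n 0 = 0 := by
  ext i
  simp [wrap]

lemma wrap_surjective (n : ℕ) : Function.Surjective (wrap d n) := fun x =>
  ⟨fun i => (ZMod.intCast_surjective (x i)).choose,
    funext fun i => (ZMod.intCast_surjective (x i)).choose_spec⟩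

lemma image_wrap_translateBy (n : ℕ) (u : Fin d → ℤ) (B : Finset (Fin d → ℤ)) :
    (translateBy u B).image (wrap d n) = (B.image (wrap d n)).image (· + wrap d n u) := by
  simp only [translateBy, Finset.image_image, Function.comp_def, wrap_add]

/-- The points of the grid with coordinates bounded by `R`. -/
def box (d R : ℕ) : Set (Fin d → ℤ) := {x | ∀ i, |x i| ≤ R}

lemma zero_mem_box (R : ℕ) : (0 : Fin d → ℤ) ∈ box d R := fun i => by simp

lemma box_mono {R R' : ℕ} (h : R ≤ R') : box d R ⊆ box d R' := fun x hx i =>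
  (hx i).trans (by exact_mod_cast h)

lemma injOn_wrap_box {n R : ℕ} (h : 2 * R < n) : Set.InjOn (wrap d n) (box d R) := by
  intro x hx y hy hxy
  ext i
  have h1 := congrFun hxy i
  simp only [wrap] at h1
  rw [ZMod.intCast_eq_intCast_iff_dvd_sub] at h1
  have h2 : |y i - x i| < n := by
    have := abs_sub (y i) (x i)
    have := hx i
    have := hy i
    have : (2 * R : ℤ) < n := by exact_mod_cast h
    linarith
  linarith [Int.eq_zero_of_abs_lt_dvd h1 h2]

variable (S) in
/-- The copies on the torus of the figures of a set, each with the figure. -/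
abbrev TorusPolymer (n : ℕ) : Type :=
  {q : S × Finset (TorusVertex d n) // IsCopy n (q.1 : Figure d) q.2}

/-- The vertices occupied by a copy of a figure. -/
abbrev torusCover {n : ℕ} (v : TorusPolymer S n) : Finset (TorusVertex d n) := v.1.2

/-- The weight of the figure of a copy. -/
abbrev torusWeight (w : S → ℕ+) {n : ℕ} (v : TorusPolymer S n) : ℕ := w v.1.1

lemma mk_empty_not_isConnected : ¬ (Figure.mk (∅ : Finset (Fin d → ℤ))).IsConnected := by
  rintro ⟨B, hB, hc⟩
  obtain ⟨u, hu⟩ := Quotient.exact hB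
  obtain ⟨x⟩ := hc.nonempty
  have hB0 : B = ∅ := by
    rw [translateBy, eq_comm, Finset.image_eq_empty] at hu
    exact hu
  have := x.2
  simp [hB0] at this

lemma nonempty_of_isConnected {B : Finset (Fin d → ℤ)} (h : (Figure.mk B).IsConnected) :
    B.Nonempty := by
  rw [Finset.nonempty_iff_ne_empty]
  rintro rfl
  exact mk_empty_not_isConnected h

lemma torusCover_nonempty (hS : ∀ f ∈ S, f.IsConnected) {n : ℕ} (v : TorusPolymer S n) :
    (torusCover v).Nonempty := by
  obtain ⟨B, hB, -, hA⟩ := v.2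
  rw [torusCover, hA]
  exact (nonempty_of_isConnected (hB ▸ hS _ v.1.1.2)).image _

lemma finite_le_weight {w : S → ℕ+} (hw : ∀ x : ℕ+, {f : S | w f = x}.Finite) (k : ℕ) :
    {f : S | (w f : ℕ) ≤ k}.Finite :=
  ((Set.finite_Iic k).preimage PNat.coe_injective.injOn).preimage' fun x _ => hw x

lemma finite_torusWeight_le {w : S → ℕ+} (hw : ∀ x : ℕ+, {f : S | w f = x}.Finite) {n : ℕ}
    [NeZero n] (k : ℕ) : {v : TorusPolymer S n | torusWeight w v ≤ k}.Finite := by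
  refine Set.Finite.of_injOn (f := Subtype.val)
    (t := {f : S | (w f : ℕ) ≤ k} ×ˢ (Set.univ : Set (Finset (TorusVertex d n))))
    ?_ Subtype.val_injective.injOn ((finite_le_weight hw k).prod Set.finite_univ)
  intro v hv
  exact ⟨hv, trivial⟩

/-- Placements correspond to the multisets of copies satisfying the hard-core condition. -/
lemma ncard_placements (hS : ∀ f ∈ S, f.IsConnected) (w : S → ℕ+) {n k : ℕ}
    {L : Finset (TorusPolymer S n →₀ ℕ)}
    (hL : ∀ a, a ∈ L ↔ Finsupp.weight (torusWeight w) a = k) :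
    (placements S w k n).Finite ∧
      ((placements S w k n).ncard : ℚ) = ∑ a ∈ L, hardCore torusCover a := by
  have hne := torusCover_nonempty (n := n) hS
  have hval : ∀ a : TorusPolymer S n →₀ ℕ, (∀ v, a v ≤ 1) → ∀ v ∈ a.support, a v = 1 :=
    fun a ha v hv => le_antisymm (ha v) (Nat.pos_of_ne_zero (Finsupp.mem_support_iff.1 hv))
  -- Covers are nonempty, so repetition-free covering forces multiplicities at most `1`; such a
  -- multiset is its support.
  have himage : placements S w k n =
      (fun a : TorusPolymer S n →₀ ℕ => a.support.map (Function.Embedding.subtype _)) ''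
        (L.filter fun a => (covering torusCover a).Nodup) := by
    ext P
    simp only [Set.mem_image, Finset.coe_filter, Set.mem_ofPred_eq]
    constructor
    · rintro ⟨hcopy, hdisj, hsum⟩
      let s : Finset (TorusPolymer S n) := P.subtype _
      let a : TorusPolymer S n →₀ ℕ := Finsupp.indicator s fun _ _ => 1
      have hs : s.map (Function.Embedding.subtype _) = P := Finset.subtype_map_of_mem hcopy
      have happ : ∀ v, a v = if v ∈ s then 1 else 0 := fun v => by
        simp [a, Finsupp.indicator_apply]
      have hsupp : a.support = s := by
        ext v
        rw [Finsupp.mem_support_iff, happ]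
        simp
      refine ⟨a, ⟨?_, ?_⟩, by rw [hsupp, hs]⟩
      · rw [hL, Finsupp.weight_apply, Finsupp.sum, hsupp, ← hsum]
        conv_rhs => rw [← hs]
        rw [Finset.sum_map]
        refine Finset.sum_congr rfl fun v hv => ?_
        rw [happ, if_pos hv, one_smul]
        rfl
      · rw [nodup_covering_iff hne, hsupp]
        refine ⟨fun v => ?_, fun v hv u hu hvu => ?_⟩
        · rw [happ]
          split_ifs <;> simp
        · exact hdisj _ (Finset.mem_subtype.1 hv) _ (Finset.mem_subtype.1 hu)
            (Subtype.val_injective.ne hvu)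
    · rintro ⟨a, ⟨ha, hnd⟩, rfl⟩
      rw [nodup_covering_iff hne] at hnd
      refine ⟨?_, ?_, ?_⟩
      · intro q hq
        obtain ⟨v, -, rfl⟩ := Finset.mem_map.1 hq
        exact v.2
      · intro q hq r hr hqr
        obtain ⟨v, hv, rfl⟩ := Finset.mem_map.1 hq
        obtain ⟨u, hu, rfl⟩ := Finset.mem_map.1 hr
        exact hnd.2 v hv u hu fun h => hqr (by rw [h])
      · rw [hL, Finsupp.weight_apply, Finsupp.sum] at ha
        rw [Finset.sum_map, ← ha]
        refine Finset.sum_congr rfl fun v hv => ?_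
        rw [hval a hnd.1 v hv, one_smul]
        rfl
  have hinj : Set.InjOn
      (fun a : TorusPolymer S n →₀ ℕ => a.support.map (Function.Embedding.subtype _))
      (L.filter fun a => (covering torusCover a).Nodup) := by
    intro a ha b hb hab
    simp only [Finset.coe_filter, Set.mem_ofPred_eq, nodup_covering_iff hne] at ha hb
    have hsupp := Finset.map_injective _ hab
    ext v
    by_cases hv : v ∈ a.support
    · rw [hval a ha.2.1 v hv, hval b hb.2.1 v (hsupp ▸ hv)]
    · have hv' := hv
      rw [hsupp] at hv'
      rw [Finsupp.notMem_support_iff.1 hv, Finsupp.notMem_support_iff.1 hv']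
  rw [himage]
  refine ⟨(Finset.finite_toSet _).image _, ?_⟩
  rw [hinj.ncard_image, Set.ncard_coe_finset]
  simp only [hardCore_apply]
  rw [Finset.card_filter, Nat.cast_sum]
  exact Finset.sum_congr rfl fun a _ => by split_ifs <;> simp

/-- Translation of the copies on the torus. -/
noncomputable def torusTranslate {n : ℕ} (x : TorusVertex d n) (v : TorusPolymer S n) :
    TorusPolymer S n :=
  ⟨(v.1.1, v.1.2.image (· + x)), by
    obtain ⟨B, hB, hinj, hA⟩ := v.2
    obtain ⟨u, rfl⟩ := wrap_surjective n x
    refine ⟨translateBy u B, (mk_translateBy u B).trans hB, ?_, ?_⟩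
    swap
    · rw [image_wrap_translateBy, hA]
    rintro _ hy _ hz hyz
    obtain ⟨y, hy', rfl⟩ := Finset.mem_image.1 (Finset.mem_coe.1 hy)
    obtain ⟨z, hz', rfl⟩ := Finset.mem_image.1 (Finset.mem_coe.1 hz)
    rw [wrap_add, wrap_add] at hyz
    rw [hinj hy' hz' (add_right_cancel hyz)]⟩

lemma torusTranslate_neg {n : ℕ} (x : TorusVertex d n) (v : TorusPolymer S n) :
    torusTranslate (-x) (torusTranslate x v) = v := by
  refine Subtype.ext (Prod.ext rfl ?_)
  simp only [torusTranslate, Finset.image_image, Function.comp_def, add_neg_cancel_right,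
    Finset.image_id']

lemma torusTranslate_injective {n : ℕ} (x : TorusVertex d n) :
    Function.Injective (torusTranslate (S := S) x) :=
  Function.LeftInverse.injective (torusTranslate_neg x)

/-- Translations are automorphisms of the polymer system acting transitively on the `n ^ d`
vertices, so every vertex has the same share as the origin. -/
lemma sum_cluster_eq_mul (hS : ∀ f ∈ S, f.IsConnected) (w : S → ℕ+) {n k : ℕ} [NeZero n]
    {L : Finset (TorusPolymer S n →₀ ℕ)}
    (hL : ∀ a, a ∈ L ↔ Finsupp.weight (torusWeight w) a = k) :
    ∑ a ∈ L, cluster torusCover (torusWeight w) a =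
      (n : ℚ) ^ d * ∑ a ∈ L, pointedCluster torusCover (torusWeight w) 0 a := by
  have htrans : ∀ x : TorusVertex d n, ∑ a ∈ L, pointedCluster torusCover (torusWeight w) x a =
      ∑ a ∈ L, pointedCluster torusCover (torusWeight w) 0 a := by
    intro x
    have hmem : ∀ y : TorusVertex d n, ∀ a ∈ L, a.mapDomain (torusTranslate y) ∈ L := by
      intro y a ha
      rw [hL] at ha ⊢
      rw [← ha]
      exact weight_mapDomain (fun v => rfl) a
    have hinv : ∀ (y z : TorusVertex d n), y + z = 0 → ∀ a : TorusPolymer S n →₀ ℕ,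
        (a.mapDomain (torusTranslate y)).mapDomain (torusTranslate z) = a := by
      intro y z hyz a
      obtain rfl : z = -y := (neg_eq_of_add_eq_zero_right hyz).symm
      rw [← Finsupp.mapDomain_comp]
      have : torusTranslate (-y) ∘ torusTranslate (S := S) y = id :=
        funext (torusTranslate_neg y)
      rw [this, Finsupp.mapDomain_id]
    symm
    refine Finset.sum_nbij' (fun a => a.mapDomain (torusTranslate x))
      (fun a => a.mapDomain (torusTranslate (-x))) (hmem x) (hmem (-x))
      (fun a _ => hinv x (-x) (add_neg_cancel x) a)
      (fun a _ => hinv (-x) x (neg_add_cancel x) a) ?_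
    intro a _
    have h := pointedCluster_mapDomain (cover := torusCover) (w := torusWeight w)
      (cover' := torusCover) (w' := torusWeight w) (φ := (· + x)) (o := 0)
      (torusTranslate_injective (S := S) x)
      (fun v => Finset.image_val_of_injOn (add_left_injective x).injOn)
      (add_left_injective x).injOn (fun v => rfl) a
    rw [← h]
    simp
  rw [← Finset.sum_congr rfl fun a _ => sum_pointedCluster (torusCover_nonempty hS) a,
    Finset.sum_comm, Finset.sum_congr rfl fun x _ => htrans x, Finset.sum_const, nsmul_eq_mul,
    Finset.card_univ, Fintype.card_fun, ZMod.card, Fintype.card_fin]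
  push_cast
  rfl

/-! ### Lifting clusters through the origin to a box in the grid. -/

variable (S) in
/-- The representatives of the figures of a set that lie in a box. -/
abbrev BoxPolymer (R : ℕ) : Type :=
  {B : Finset (Fin d → ℤ) // Figure.mk B ∈ S ∧ (B : Set (Fin d → ℤ)) ⊆ box d R}

/-- The weight of the figure represented by a finite set in a box. -/
abbrev boxWeight (w : S → ℕ+) {R : ℕ} (B : BoxPolymer S R) : ℕ := w ⟨Figure.mk B.1, B.2.1⟩

/-- The reduction of a finite set in a box, modulo a number exceeding the size of the box. -/
def boxWrap {n R : ℕ} (h : 2 * R < n) (B : BoxPolymer S R) : TorusPolymer S n :=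
  ⟨(⟨Figure.mk B.1, B.2.1⟩, B.1.image (wrap d n)), B.1, rfl, (injOn_wrap_box h).mono B.2.2, rfl⟩

lemma boxWrap_injective {n R : ℕ} (h : 2 * R < n) :
    Function.Injective (boxWrap (S := S) h) := by
  intro B C hBC
  have h1 : B.1.image (wrap d n) = C.1.image (wrap d n) := congrArg (fun v => v.1.2) hBC
  refine Subtype.ext (Finset.coe_injective ?_)
  refine ((injOn_wrap_box h).image_eq_image_iff B.2.2 C.2.2).1 ?_
  rw [← Finset.coe_image, ← Finset.coe_image, h1]

/-- The copy arises from a representative in the box. -/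
def LiesInBox {n : ℕ} (R : ℕ) (v : TorusPolymer S n) : Prop :=
  ∃ B : Finset (Fin d → ℤ), Figure.mk B = v.1.1 ∧ (B : Set (Fin d → ℤ)) ⊆ box d R ∧
    v.1.2 = B.image (wrap d n)

lemma LiesInBox.mono {n R R' : ℕ} (h : R ≤ R') {v : TorusPolymer S n} (hv : LiesInBox R v) :
    LiesInBox R' v := by
  obtain ⟨B, h1, h2, h3⟩ := hv
  exact ⟨B, h1, h2.trans (box_mono h), h3⟩

lemma LiesInBox.exists_boxWrap_eq {n R : ℕ} (h : 2 * R < n) {v : TorusPolymer S n}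
    (hv : LiesInBox R v) : ∃ B, boxWrap h B = v := by
  obtain ⟨⟨⟨f, hf⟩, A⟩, hA⟩ := v
  obtain ⟨B, h1, h2, h3⟩ := hv
  dsimp only at h1 h3
  subst h1 h3
  exact ⟨⟨B, hf, h2⟩, rfl⟩

/-- If `z` in a representative reduces to the same vertex as `y`, then translating by `y - z`, which
is `0` modulo `n`, gives a representative of the same copy through `y`. -/
lemma liesInBox_of_mem {n R D : ℕ} {v : TorusPolymer S n}
    (hD : ∀ B : Finset (Fin d → ℤ), Figure.mk B = v.1.1 →
      ∀ x ∈ B, ∀ y ∈ B, ∀ i, |x i - y i| ≤ D)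
    {y : Fin d → ℤ} (hy : y ∈ box d R) (hyv : wrap d n y ∈ torusCover v) :
    LiesInBox (R + D) v := by
  obtain ⟨B, hB, hinj, hA⟩ := v.2
  rw [torusCover, hA] at hyv
  obtain ⟨z, hz, hzy⟩ := Finset.mem_image.1 hyv
  have hB' : Figure.mk (translateBy (y - z) B) = v.1.1 := (mk_translateBy _ B).trans hB
  have hyB : y ∈ translateBy (y - z) B := Finset.mem_image.2 ⟨z, hz, by simp⟩
  refine ⟨translateBy (y - z) B, hB', ?_, ?_⟩
  · intro x hx i
    have h1 := hD _ hB' x hx y hyB i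
    have h2 := hy i
    have h3 := abs_add_le (x i - y i) (y i)
    rw [sub_add_cancel] at h3
    push_cast
    linarith
  · have h0 : wrap d n (y - z) = 0 := by
      have := wrap_add n (y - z) z
      rw [sub_add_cancel, hzy] at this
      simpa using this
    rw [image_wrap_translateBy, h0, hA]
    simp

lemma exists_diam (f : Figure d) : ∃ D : ℕ, ∀ B : Finset (Fin d → ℤ), Figure.mk B = f →
    ∀ x ∈ B, ∀ y ∈ B, ∀ i, |x i - y i| ≤ D := by
  induction f using Quotient.inductionOn with
  | _ C =>
  refine ⟨(C ×ˢ C).sum fun z => ∑ i, (z.1 i - z.2 i).natAbs, fun B hB x hx y hy i => ?_⟩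
  obtain ⟨u, rfl⟩ := Quotient.exact hB.symm
  obtain ⟨x, hx', rfl⟩ := Finset.mem_image.1 hx
  obtain ⟨y, hy', rfl⟩ := Finset.mem_image.1 hy
  have h1 : (x i - y i).natAbs ≤ ∑ i, (x i - y i).natAbs :=
    Finset.single_le_sum (f := fun i => (x i - y i).natAbs) (fun _ _ => Nat.zero_le _)
      (Finset.mem_univ i)
  have h2 := Finset.single_le_sum (f := fun z : (Fin d → ℤ) × (Fin d → ℤ) =>
    ∑ i, (z.1 i - z.2 i).natAbs) (fun _ _ => Nat.zero_le _) (Finset.mk_mem_product hx' hy')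
  rw [Pi.add_apply, Pi.add_apply, add_sub_add_right_eq_sub, Int.abs_eq_natAbs]
  exact_mod_cast h1.trans h2

lemma exists_common_diam {w : S → ℕ+} (hw : ∀ x : ℕ+, {f : S | w f = x}.Finite) (k : ℕ) :
    ∃ D : ℕ, ∀ f : S, (w f : ℕ) ≤ k → ∀ B : Finset (Fin d → ℤ), Figure.mk B = f →
      ∀ x ∈ B, ∀ y ∈ B, ∀ i, |x i - y i| ≤ D := by
  choose D hD using fun f : Figure d => exists_diam f
  refine ⟨∑ f ∈ (finite_le_weight hw k).toFinset, D f, fun f hf B hB x hx y hy i => ?_⟩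
  refine (hD f B hB x hx y hy i).trans ?_
  have := Finset.single_le_sum (f := fun f : S => D f) (fun _ _ => Nat.zero_le _)
    ((finite_le_weight hw k).mem_toFinset.2 hf)
  exact_mod_cast this

/-- Clusters through the origin lie in a box whose size depends on the weight alone. -/
lemma liesInBox_of_pointedCluster_ne_zero (hS : ∀ f ∈ S, f.IsConnected) {w : S → ℕ+} {k D : ℕ}
    (hD : ∀ f : S, (w f : ℕ) ≤ k → ∀ B : Finset (Fin d → ℤ), Figure.mk B = f →
      ∀ x ∈ B, ∀ y ∈ B, ∀ i, |x i - y i| ≤ D) {n : ℕ} {b : TorusPolymer S n →₀ ℕ}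
    (hb : Finsupp.weight (torusWeight w) b = k)
    (hc : pointedCluster torusCover (torusWeight w) 0 b ≠ 0) :
    ∀ v ∈ b.support, LiesInBox (k * D) v := by
  have hpos : ∀ v : TorusPolymer S n, 0 < torusWeight w v := fun v => (w v.1.1).pos
  have hdiam : ∀ v ∈ b.support, ∀ B : Finset (Fin d → ℤ), Figure.mk B = v.1.1 →
      ∀ x ∈ B, ∀ y ∈ B, ∀ i, |x i - y i| ≤ D := fun v hv => hD v.1.1
    (hb ▸ Finsupp.le_weight_of_ne_zero' (torusWeight w) (Finsupp.mem_support_iff.1 hv))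
  have hc1 : cluster torusCover (torusWeight w) b ≠ 0 := fun h => hc (by simp [pointedCluster, h])
  have hc2 : (0 : TorusVertex d n) ∈ covering torusCover b := by
    by_contra h
    exact hc (by simp [pointedCluster, h])
  obtain ⟨v₀, hv₀, h0⟩ := (mem_covering _).1 hc2
  -- Each passage to an overlapping polymer enlarges the box by `D`. At most `k` steps are needed,
  -- since every polymer has weight at least `1`.
  have key := forall_of_cluster_ne_zero (torusCover_nonempty hS) hc1
    (Q := fun r v => LiesInBox (r * D) v)
    (fun r v h => h.mono (Nat.mul_le_mul_right D (Nat.le_succ r)))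
    ⟨v₀, hv₀, by
      have := liesInBox_of_mem (hdiam v₀ hv₀) (zero_mem_box 0) (by rwa [wrap_zero])
      simpa using this⟩
    (by
      rintro r v hv u x ⟨B, -, hB, hBu⟩ hxu hxv
      rw [torusCover, hBu] at hxu
      obtain ⟨y, hy, rfl⟩ := Finset.mem_image.1 hxu
      rw [Nat.succ_mul]
      exact liesInBox_of_mem (hdiam v hv) (hB hy) hxv)
  exact fun v hv => (key v hv).mono
    (Nat.mul_le_mul_right D (hb ▸ card_support_le_weight hpos b))

/-- The sum of the cluster coefficients at the origin does not depend on the size of a large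
torus. -/
lemma exists_sum_pointedCluster_eq (hS : ∀ f ∈ S, f.IsConnected) {w : S → ℕ+}
    (hw : ∀ x : ℕ+, {f : S | w f = x}.Finite) (k : ℕ) :
    ∃ h : ℚ, ∃ n₀ : ℕ, ∀ n, n₀ ≤ n → ∀ L : Finset (TorusPolymer S n →₀ ℕ),
      (∀ a, a ∈ L ↔ Finsupp.weight (torusWeight w) a = k) →
        ∑ a ∈ L, pointedCluster torusCover (torusWeight w) 0 a = h := by
  obtain ⟨D, hD⟩ := exists_common_diam hw k
  -- The value is computed in the grid, without reference to `n`. Restricting to nonzero terms makes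
  -- the index set biject with the contributing torus clusters once `2 * (k * D) < n`, when the box
  -- reduces injectively.
  refine ⟨∑ᶠ (a : BoxPolymer S (k * D) →₀ ℕ)
    (_ : a ∈ {a | Finsupp.weight (boxWeight w) a = k ∧
      pointedCluster Subtype.val (boxWeight w) 0 a ≠ 0}),
    pointedCluster Subtype.val (boxWeight w) 0 a, 2 * (k * D) + 1, fun n hn L hL => ?_⟩
  have hn : 2 * (k * D) < n := hn
  have hcov : ∀ B : BoxPolymer S (k * D), (torusCover (boxWrap hn B)).val = B.1.val.map (wrap d n) :=
    fun B => Finset.image_val_of_injOn ((injOn_wrap_box hn).mono B.2.2)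
  have hinj : Set.InjOn (wrap d n) (insert 0 {x | ∃ B : BoxPolymer S (k * D), x ∈ B.1}) := by
    refine (injOn_wrap_box hn).mono (Set.insert_subset (zero_mem_box _) ?_)
    rintro x ⟨B, hx⟩
    exact B.2.2 hx
  have hpc : ∀ a : BoxPolymer S (k * D) →₀ ℕ,
      pointedCluster torusCover (torusWeight w) 0 (a.mapDomain (boxWrap hn)) =
        pointedCluster Subtype.val (boxWeight w) 0 a := by
    intro a
    rw [← wrap_zero]
    exact pointedCluster_mapDomain (boxWrap_injective hn) hcov hinj (fun _ => rfl) a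
  have hwt : ∀ a : BoxPolymer S (k * D) →₀ ℕ,
      Finsupp.weight (torusWeight w) (a.mapDomain (boxWrap hn)) =
        Finsupp.weight (boxWeight w) a :=
    weight_mapDomain fun _ => rfl
  rw [← Finset.sum_filter_ne_zero, ← finsum_mem_coe_finset]
  symm
  refine finsum_mem_eq_of_bijOn (fun a => a.mapDomain (boxWrap hn)) ⟨?_, ?_, ?_⟩
    fun a _ => (hpc a).symm
  · rintro a ⟨h1, h2⟩
    rw [Finset.mem_coe, Finset.mem_filter, hL, hwt, hpc]
    exact ⟨h1, h2⟩
  · exact (Finsupp.mapDomain_injective (boxWrap_injective hn)).injOn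
  · intro b hb
    rw [Finset.mem_coe, Finset.mem_filter, hL] at hb
    obtain ⟨a, rfl⟩ := exists_mapDomain_eq (boxWrap_injective hn) fun v hv =>
      (liesInBox_of_pointedCluster_ne_zero hS hD hb.1 hb.2 v hv).exists_boxWrap_eq hn
    rw [hwt, hpc] at hb
    exact ⟨a, hb, rfl⟩

end Torus

end TorusPlacement

theorem mainTheorem6 (d : ℕ) (S : Set (TorusPlacement.Figure d))
    (hS : ∀ f ∈ S, f.IsConnected) (w : S → ℕ+)
    (hw : ∀ x : ℕ+, {f : S | w f = x}.Finite) :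
    ∃ p : ℕ → Polynomial ℚ,
      (∀ k : ℕ, ∃ n₀ : ℕ, ∀ n : ℕ, n₀ ≤ n →
        (TorusPlacement.placements S w k n).Finite ∧
        ((TorusPlacement.placements S w k n).ncard : ℚ) = (p k).eval ((n : ℚ) ^ d)) ∧
      TorusPlacement.IsBinomialType p := by
  open TorusPlacement in
  choose h n₀ hsum using fun k => exists_sum_pointedCluster_eq hS hw k
  -- The recursion requires `h 0 = 0`; the update ensures this, and `expSeq` uses only positive
  -- indices.
  refine ⟨expSeq (Function.update h 0 0), fun K => ?_, isBinomialType_expSeq _⟩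
  -- The recursion for `P_K` passes through all weights up to `K`, so all their thresholds are
  -- needed; the `+ 1` makes `n` nonzero.
  refine ⟨(Finset.range (K + 1)).sup n₀ + 1, fun n hn => ?_⟩
  have : NeZero n := ⟨by omega⟩
  have hpos : ∀ v : TorusPolymer S n, 0 < torusWeight w v := fun v => (w v.1.1).pos
  let L (k : ℕ) : Finset (TorusPolymer S n →₀ ℕ) :=
    (finite_weight_eq hpos (finite_torusWeight_le hw) k).toFinset
  have hL : ∀ k a, a ∈ L k ↔ Finsupp.weight (torusWeight w) a = k := fun k a => by simp [L]
  have hL0 : L 0 = {0} := by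
    ext a
    rw [hL, Finset.mem_singleton]
    refine ⟨fun ha => ?_, fun ha => by simp [ha]⟩
    have := card_support_le_weight hpos a
    rw [ha, Nat.le_zero, Finset.card_eq_zero] at this
    exact Finsupp.support_eq_empty.1 this
  refine ⟨(ncard_placements hS w (hL K)).1, ?_⟩
  rw [(ncard_placements hS w (hL K)).2]
  refine eq_eval_expSeq (P := fun k => ∑ a ∈ L k, hardCore torusCover a)
    (Function.update_self 0 0 h) K (by simp [hL0]) (fun k hk => ?_) K le_rfl
  rw [weight_mul_sum_hardCore hL]
  refine Finset.sum_congr rfl fun x hx => ?_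
  congr 1
  rw [Finset.HasAntidiagonal.mem_antidiagonal] at hx
  rcases Nat.eq_zero_or_pos x.1 with h0 | h0
  · simp [h0, hL0]
  · rw [sum_cluster_eq_mul hS w (hL x.1), hsum x.1 n ?_ (L x.1) (hL x.1),
      Function.update_of_ne h0.ne']
    have := Finset.le_sup (f := n₀) (Finset.mem_range.2 (show x.1 < K + 1 by omega))
    omega
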